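/- Let $n\ge 1$ and $\gamma_1,\dots,\gamma_{n+1}\in[0,1]$. Consider a quantum network of $n$ independent sources and $n+1$ nodes. Source $i$ prepares two qubits in an arbitrary state $\rho_i$, so that the joint state is $\rho=\bigotimes_{i=1}^n\rho_i$. On the input $x_j\in\{0,1\}$, node $j$ measures a projection-valued measure $\{\Pi^{j}_{b|x_j}\}_{b=\pm1}$ on the qubits it holds. Each output then suffers a white-noise detector error: with $$W_\gamma=(1-\gamma)\mathbb I+\frac{\gamma}{2}\begin{pmatrix}1&1\\1&1\end{pmatrix}$$ the behavior of the network is $$P(\vec a|\vec x)=\sum_{\vec b\in\{\pm1\}^{n+1}}\ \prod_{j=1}^{n+1}(W_{\gamma_j})_{a_j b_j}\ \mathrm{tr}\Big[\Big(\bigotimes_{j=1}^{n+1}\Pi^{j}_{b_j|x_j}\Big)\rho\Big].$$ Let $E(\vec x)=\sum_{\vec a}a_1\cdots a_{n+1}P(\vec a|\vec x)$ denote the full correlator. In the $n$-local star, node $j\le n$ holds one qubit of source $j$, and the central node $n+1$ holds the other qubit of every source. Its score is $S_{n\text{-Star}}=|I_0|^{1/n}+|I_1|^{1/n}$, where $$I_y=2^{-n}\sum_{x_1,\dots,x_n\in\{0,1\}}(-1)^{y(x_1+\dots+x_n)}E(x_1,\dots,x_n,y).$$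 In the $n$-local chain, source $i$ sends one qubit to node $i$ and the other to node $i+1$. Its score is $S_{n\text{-Chain}}=\sqrt{|J_0|}+\sqrt{|J_1|}$, where $$J_y=\frac14\sum_{x,x'\in\{0,1\}}(-1)^{y(x+x')}E(x,y,\dots,y,x'),$$ with inputs $x$, $x'$ at the two end nodes and $y$ at all the interior nodes. Then the maxima over all states $\rho_1,\dots,\rho_n$ and all projection-valued measures of the nodes exist and equal $$S^\star_{n\text{-Star}}=\sqrt2\Big(\prod_{j=1}^{n+1}(1-\gamma_j)\Big)^{1/n},\qquad S^\star_{n\text{-Chain}}=\sqrt2\,\sqrt{\prod_{j=1}^{n+1}(1-\gamma_j)}.$$ -/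

import Mathlib

open scoped ComplexOrder

namespace NLocal

/-- A density matrix on the finite-dimensional Hilbert space with orthonormal basis `H`. -/
structure DensityMatrix (H : Type) [Fintype H] where
  val : Matrix H H ℂ
  posSemidef : val.PosSemidef
  trace_eq_one : val.trace = 1

/-- A projection-valued measure with outcomes in `O`, on the finite-dimensional Hilbert space with
orthonormal basis `H`. -/
structure PVM (O H : Type) [Fintype O] [Fintype H] [DecidableEq H] where
  proj : O → Matrix H H ℂ
  isStarProjection : ∀ a, IsStarProjection (proj a)
  orthogonal : ∀ a b, a ≠ b → proj a * proj b = 0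
  sum_eq_one : ∑ a, proj a = 1

/-- The topology of a network with `n` sources and `m` nodes on the qubits `Q`: every qubit is
prepared by exactly one source and measured by exactly one node. -/
structure Network (n m : ℕ) (Q : Type) where
  source : Q → Fin n
  node : Q → Fin m

/-- A network behavior for nodes with binary inputs `0, 1` and binary outputs `±1`: the matrix of
the conditional probabilities `P(a|x)`, with rows `a` and columns `x`. -/
abbrev Behavior (m : ℕ) : Type := Matrix (Fin m → ℤˣ) (Fin m → Fin 2) ℝ

namespace Network

variable {n m : ℕ} {Q : Type} [Fintype Q] [DecidableEq Q]

/-- Labels of the computational basis of the qubits emitted by source `i`. -/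
abbrev SourceBasis (N : Network n m Q) (i : Fin n) : Type := {q : Q // N.source q = i} → Fin 2

/-- Labels of the computational basis of the qubits held by node `j`. -/
abbrev NodeBasis (N : Network n m Q) (j : Fin m) : Type := {q : Q // N.node q = j} → Fin 2

/-- The joint state `⨂ i, ρ i` of independent sources, as an operator on all the qubits. -/
def netState (N : Network n m Q) (ρ : ∀ i, DensityMatrix (N.SourceBasis i)) :
    Matrix (Q → Fin 2) (Q → Fin 2) ℂ :=
  Matrix.of fun s t => ∏ i, (ρ i).val (fun q => s q.1) (fun q => t q.1)

/-- The operator `⨂ j, E j` of operators on the local qubits of the nodes, as an operator on all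
the qubits. -/
def netOperator (N : Network n m Q) (E : ∀ j, Matrix (N.NodeBasis j) (N.NodeBasis j) ℂ) :
    Matrix (Q → Fin 2) (Q → Fin 2) ℂ :=
  Matrix.of fun s t => ∏ j, E j (fun q => s q.1) (fun q => t q.1)

/-- The noiseless behavior, by the Born rule: node `j` measures the PVM `M j (x j)` on
its local qubits. The trace is real, being that of a product of two positive semidefinite
matrices. -/
noncomputable def bornBehavior (N : Network n m Q) (ρ : ∀ i, DensityMatrix (N.SourceBasis i))
    (M : ∀ j, Fin 2 → PVM ℤˣ (N.NodeBasis j)) : Behavior m :=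
  Matrix.of fun a x =>
    (Matrix.trace (N.netOperator (fun j => (M j (x j)).proj (a j)) * N.netState ρ)).re

end Network

/-- The white noise detector error `W_γ = (1 - γ) 𝟙 + (γ / 2) [[1, 1], [1, 1]]`, a stochastic map on
the binary output of one detector. -/
noncomputable def whiteNoise (γ : ℝ) : Matrix ℤˣ ℤˣ ℝ :=
  (1 - γ) • (1 : Matrix ℤˣ ℤˣ ℝ) + (γ / 2) • Matrix.of fun _ _ => 1

/-- The classical post-processing `⨂ j, W_{γ j}` of the outputs of all the detectors. -/
noncomputable def netWhiteNoise {m : ℕ} (γ : Fin m → ℝ) :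
    Matrix (Fin m → ℤˣ) (Fin m → ℤˣ) ℝ :=
  Matrix.of fun a b => ∏ j, whiteNoise (γ j) (a j) (b j)

/-- All the quantum behaviors of the network `N` when detector `j` suffers from the white noise
error `W_{γ j}`. -/
def noisyQuantumSet {n m : ℕ} {Q : Type} [Fintype Q] [DecidableEq Q] (N : Network n m Q)
    (γ : Fin m → ℝ) : Set (Behavior m) :=
  {P | ∃ (ρ : ∀ i, DensityMatrix (N.SourceBasis i)) (M : ∀ j, Fin 2 → PVM ℤˣ (N.NodeBasis j)),
    P = netWhiteNoise γ * N.bornBehavior ρ M}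

/-- The full correlator `⟨O_{x_1} ⋯ O_{x_m}⟩`: the expected parity of the outputs on the
inputs `x`. -/
def correlator {m : ℕ} (P : Behavior m) (x : Fin m → Fin 2) : ℝ :=
  ∑ a : Fin m → ℤˣ, (∏ j, ((a j : ℤ) : ℝ)) * P a x

/-- The `n`-local star: source `i` emits the qubits `(i, 0)` and `(i, 1)`; the exterior node
`i.castSucc` holds `(i, 0)`, and the central node `Fin.last n` holds all the `(i, 1)`. -/
def star (n : ℕ) : Network n (n + 1) (Fin n × Fin 2) where
  source q := q.1
  node q := if q.2 = 0 then q.1.castSucc else Fin.last n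

/-- The `n`-local chain: source `i` emits the qubits `(i, 0)` and `(i, 1)`, of which `(i, 0)` goes to
node `i` and `(i, 1)` to node `i + 1`. So the first and the last node hold one qubit, and every
interior node holds two qubits, from consecutive sources. -/
def chain (n : ℕ) : Network n (n + 1) (Fin n × Fin 2) where
  source q := q.1
  node q := if q.2 = 0 then q.1.castSucc else q.1.succ

/-- The quantity `I_{n,y} = 2⁻ⁿ ∑_x (-1)^{y (x_1 + ⋯ + x_n)} ⟨O^{A_1}_{x_1} ⋯ O^{A_n}_{x_n} O^B_y⟩`. -/
noncomputable def starI {n : ℕ} (P : Behavior (n + 1)) (y : Fin 2) : ℝ :=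
  (1 / 2 ^ n) * ∑ x : Fin n → Fin 2,
    (-1) ^ ((y : ℕ) * ∑ j, (x j : ℕ)) * correlator P (Fin.snoc (α := fun _ => Fin 2) x y)

/-- The star score `|I_{n,0}|^{1/n} + |I_{n,1}|^{1/n}`. -/
noncomputable def starScore {n : ℕ} (P : Behavior (n + 1)) : ℝ :=
  |starI P 0| ^ (1 / (n : ℝ)) + |starI P 1| ^ (1 / (n : ℝ))

/-- The inputs of the nodes of the chain: `x₁` and `x₂` at the two ends, and `y` at all the interior
nodes. -/
def chainInput (n : ℕ) (x₁ x₂ y : Fin 2) : Fin (n + 1) → Fin 2 :=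
  fun k => if k = 0 then x₁ else if k = Fin.last n then x₂ else y

/-- The quantity
`I_{2,y} = (1/4) ∑_{x₁, x₂} (-1)^{y (x₁ + x₂)} ⟨O^{A_1}_{x₁} O^{B_2}_y ⋯ O^{B_n}_y O^{A_2}_{x₂}⟩`. -/
noncomputable def chainI {n : ℕ} (P : Behavior (n + 1)) (y : Fin 2) : ℝ :=
  (1 / 4) * ∑ x₁ : Fin 2, ∑ x₂ : Fin 2,
    (-1) ^ ((y : ℕ) * ((x₁ : ℕ) + (x₂ : ℕ))) * correlator P (chainInput n x₁ x₂ y)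

/-- The chain score `√|I_{2,0}| + √|I_{2,1}|`. -/
noncomputable def chainScore {n : ℕ} (P : Behavior (n + 1)) : ℝ :=
  √|chainI P 0| + √|chainI P 1|

end NLocal

/-! White noise is local and unbiased, so it multiplies the full correlator of any behavior by `∏ j,
(1 - γ j)` (`correlator_netWhiteNoise_mul`). It remains to see that both noiseless maxima are `√2`.

By multilinearity each score quantity is the expectation of one product operator (`starI_eq`,
`chainI_eq`), in which a node with summed input carries `C_y = (A₀ + (-1)^y A₁) / 2` and any other
node a `±1`-valued observable. The upper bounds rest on `C₀² + C₁² = 1`.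

Chain: Cauchy–Schwarz, with the first node split from the rest, bounds `2|J_y|` by the sum of
`⟨C_y²⟩` at the two ends, since interior observables square to `1`. Summing over `y` gives `|J₀| +
|J₁| ≤ 1`, hence `√|J₀| + √|J₁| ≤ √2`.

Star: `I_y² ≤ ⟨X²⟩` removes the central observable, and independence of the sources factors `⟨X²⟩`
into the `⟨C_y²⟩` of the exterior nodes. AM–GM over these nodes reduces the sum over `y` to `√c₀ +
√c₁ ≤ √2` with `c₀ + c₁ = 1`.

Equality: Bell states, `(Z ± X) / √2` where the input is summed, and `Z ⊗ ⋯ ⊗ Z` or `X ⊗ ⋯ ⊗ X`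
elsewhere. -/

namespace NLocal

open scoped Matrix

/-! ### Tensor products along the fibers of a map -/

section FiberProd

variable {Q : Type} {k : ℕ}

/-- The tensor product of operators acting on the qubits in the fibers of `f`. -/
def fiberProd (f : Q → Fin k) (E : ∀ i, Matrix ({q // f q = i} → Fin 2) ({q // f q = i} → Fin 2) ℂ) :
    Matrix (Q → Fin 2) (Q → Fin 2) ℂ :=
  Matrix.of fun s t => ∏ i, E i (fun q => s q.1) (fun q => t q.1)

/-- Bit strings on `Q` are families of bit strings on the fibers of `f`. -/
def fiberEquiv (f : Q → Fin k) : (Q → Fin 2) ≃ ∀ i, ({q // f q = i} → Fin 2) where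
  toFun t _ q := t q.1
  invFun u q := u (f q) ⟨q, rfl⟩
  left_inv _ := rfl
  right_inv u := by
    funext i ⟨q, h⟩
    subst h
    rfl

variable [Fintype Q]

lemma sum_prod_fiber [DecidableEq Q] (f : Q → Fin k) (F : ∀ i, ({q // f q = i} → Fin 2) → ℂ) :
    ∑ t : Q → Fin 2, ∏ i, F i (fun q => t q.1) = ∏ i, ∑ u, F i u := by
  rw [Finset.prod_univ_sum, Fintype.piFinset_univ]
  exact Fintype.sum_equiv (fiberEquiv f) _ _ fun _ => rfl

lemma fiberProd_mul [DecidableEq Q] (f : Q → Fin k)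
    (E F : ∀ i, Matrix ({q // f q = i} → Fin 2) ({q // f q = i} → Fin 2) ℂ) :
    fiberProd f E * fiberProd f F = fiberProd f (fun i => E i * F i) := by
  ext s t
  simp only [fiberProd, Matrix.mul_apply, Matrix.of_apply, ← Finset.prod_mul_distrib]
  exact sum_prod_fiber f fun i u => E i (fun q => s q.1) u * F i u (fun q => t q.1)

lemma trace_fiberProd [DecidableEq Q] (f : Q → Fin k)
    (E : ∀ i, Matrix ({q // f q = i} → Fin 2) ({q // f q = i} → Fin 2) ℂ) :
    (fiberProd f E).trace = ∏ i, (E i).trace := by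
  simp only [fiberProd, Matrix.trace, Matrix.diag, Matrix.of_apply]
  exact sum_prod_fiber f fun i u => E i u u

omit [Fintype Q] in
lemma fiberProd_conjTranspose (f : Q → Fin k)
    (E : ∀ i, Matrix ({q // f q = i} → Fin 2) ({q // f q = i} → Fin 2) ℂ) :
    (fiberProd f E)ᴴ = fiberProd f (fun i => (E i)ᴴ) := by
  ext s t
  simp [fiberProd, Matrix.conjTranspose_apply]

lemma fiberProd_one [DecidableEq Q] (f : Q → Fin k) : fiberProd f (fun _ => 1) = 1 := by
  ext s t
  simp only [fiberProd, Matrix.of_apply, Matrix.one_apply]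
  rw [Finset.prod_ite_zero]
  have : (∀ i ∈ (Finset.univ : Finset (Fin k)),
      (fun q : {q // f q = i} => s q.1) = fun q => t q.1) ↔ s = t := by
    refine ⟨fun h => funext fun q => congrFun (h (f q) (Finset.mem_univ _)) ⟨q, rfl⟩, ?_⟩
    rintro rfl i -
    rfl
  simp only [this, Finset.prod_const_one]

/-- Factoring every `E i` as `Bᴴ * B` gives such a factorization of the product. -/
lemma fiberProd_posSemidef [DecidableEq Q] (f : Q → Fin k)
    {E : ∀ i, Matrix ({q // f q = i} → Fin 2) ({q // f q = i} → Fin 2) ℂ}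
    (hE : ∀ i, (E i).PosSemidef) : (fiberProd f E).PosSemidef := by
  have h : ∀ i, ∃ B : Matrix ({q // f q = i} → Fin 2) ({q // f q = i} → Fin 2) ℂ, E i = Bᴴ * B :=
    fun i => by
      open scoped MatrixOrder in
      obtain ⟨B, hB⟩ := CStarAlgebra.nonneg_iff_eq_star_mul_self.mp (hE i).nonneg
      exact ⟨B, hB⟩
  choose B hB using h
  rw [funext hB, ← fiberProd_mul, ← fiberProd_conjTranspose]
  exact Matrix.posSemidef_conjTranspose_mul_self _

omit [Fintype Q] in
lemma fiberProd_smul (f : Q → Fin k) (c : Fin k → ℂ)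
    (E : ∀ i, Matrix ({q // f q = i} → Fin 2) ({q // f q = i} → Fin 2) ℂ) :
    fiberProd f (fun i => c i • E i) = (∏ i, c i) • fiberProd f E := by
  ext s t
  simp [fiberProd, Finset.prod_mul_distrib]

omit [Fintype Q] in
lemma fiberProd_sum {β : Type} [Fintype β] (f : Q → Fin k)
    (E : ∀ i, β → Matrix ({q // f q = i} → Fin 2) ({q // f q = i} → Fin 2) ℂ) :
    fiberProd f (fun i => ∑ b, E i b) = ∑ b : Fin k → β, fiberProd f (fun i => E i (b i)) := by
  classical
  ext s t
  simp only [fiberProd, Matrix.sum_apply, Matrix.of_apply]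
  rw [Finset.prod_univ_sum, Fintype.piFinset_univ]

omit [Fintype Q] in
lemma fiberProd_update_add (f : Q → Fin k) (j : Fin k)
    (E : ∀ i, Matrix ({q // f q = i} → Fin 2) ({q // f q = i} → Fin 2) ℂ)
    (A B : Matrix ({q // f q = j} → Fin 2) ({q // f q = j} → Fin 2) ℂ) :
    fiberProd f (Function.update E j (A + B)) =
      fiberProd f (Function.update E j A) + fiberProd f (Function.update E j B) := by
  ext s t
  simp only [fiberProd, Matrix.add_apply, Matrix.of_apply]
  have h : ∀ X, ∏ i, Function.update E j X i (fun q => s q.1) (fun q => t q.1) =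
      X (fun q => s q.1) (fun q => t q.1) *
        ∏ i ∈ Finset.univ.erase j, E i (fun q => s q.1) (fun q => t q.1) := fun X => by
    rw [← Finset.mul_prod_erase _ _ (Finset.mem_univ j), Function.update_self]
    congr 1
    refine Finset.prod_congr rfl fun i hi => ?_
    rw [Function.update_of_ne (Finset.ne_of_mem_erase hi)]
  rw [h, h, h, Matrix.add_apply, add_mul]

end FiberProd

/-! ### Binary observables and their half-sums -/

/-- The `±1`-valued observable of a PVM. -/
def PVM.obs {H : Type} [Fintype H] [DecidableEq H] (M : PVM ℤˣ H) : Matrix H H ℂ :=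
  M.proj 1 - M.proj (-1)

section Observable

variable {H : Type} [Fintype H] [DecidableEq H]

lemma PVM.sum_smul_proj (M : PVM ℤˣ H) : ∑ b : ℤˣ, ((b : ℤ) : ℂ) • M.proj b = M.obs := by
  rw [UnitsInt.univ, Finset.sum_pair (by decide)]
  simp [PVM.obs, sub_eq_add_neg]

lemma PVM.obs_conjTranspose (M : PVM ℤˣ H) : M.obsᴴ = M.obs := by
  simp only [PVM.obs, Matrix.conjTranspose_sub]
  congr 1 <;> exact (M.isStarProjection _).isSelfAdjoint

lemma PVM.obs_mul_self (M : PVM ℤˣ H) : M.obs * M.obs = 1 := by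
  have h := M.sum_eq_one
  rw [UnitsInt.univ, Finset.sum_pair (by decide)] at h
  have h1 := (M.isStarProjection 1).isIdempotentElem.eq
  have h2 := (M.isStarProjection (-1)).isIdempotentElem.eq
  rw [PVM.obs, sub_mul, mul_sub, mul_sub, h1, h2, M.orthogonal _ _ (by decide),
    M.orthogonal _ _ (by decide), ← h]
  abel

/-- The combination `(A₀ + (-1) ^ y A₁) / 2` of two observables. -/
noncomputable def endCombo (M : Fin 2 → PVM ℤˣ H) (y : Fin 2) : Matrix H H ℂ :=
  (1 / 2 : ℂ) • ((M 0).obs + (-1 : ℂ) ^ (y : ℕ) • (M 1).obs)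

lemma endCombo_conjTranspose (M : Fin 2 → PVM ℤˣ H) (y : Fin 2) :
    (endCombo M y)ᴴ = endCombo M y := by
  simp [endCombo, PVM.obs_conjTranspose]

/-- The cross terms `A₀A₁ + A₁A₀` cancel, and each observable squares to `1`. -/
lemma endCombo_mul_self_add (M : Fin 2 → PVM ℤˣ H) :
    endCombo M 0 * endCombo M 0 + endCombo M 1 * endCombo M 1 = 1 := by
  have h0 := (M 0).obs_mul_self
  have h1 := (M 1).obs_mul_self
  simp only [endCombo, Fin.val_zero, Fin.val_one, pow_zero, pow_one, Matrix.smul_mul,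
    Matrix.mul_smul, mul_add, add_mul, h0, h1]
  module

end Observable

/-! ### Cauchy–Schwarz and variance inequalities for expectations -/

/-- The expectation value `re tr (X σ)`. -/
noncomputable def expect {H : Type} [Fintype H] (σ : Matrix H H ℂ) : Matrix H H ℂ →ₗ[ℝ] ℝ where
  toFun X := (X * σ).trace.re
  map_add' X Y := by simp [add_mul]
  map_smul' r X := by simp

lemma expect_conjTranspose_mul_self_nonneg {H : Type} [Fintype H] {σ : Matrix H H ℂ}
    (hσ : σ.PosSemidef) (X : Matrix H H ℂ) : 0 ≤ expect σ (Xᴴ * X) := by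
  have h := (hσ.mul_mul_conjTranspose_same X).trace_nonneg
  have h2 : (Xᴴ * X * σ).trace = (X * σ * Xᴴ).trace := by
    rw [mul_assoc, Matrix.trace_mul_comm]
  change 0 ≤ (Xᴴ * X * σ).trace.re
  rw [h2]
  exact (Complex.le_def.mp h).1

lemma expect_conjTranspose {H : Type} [Fintype H] {σ : Matrix H H ℂ}
    (hσ : σ.PosSemidef) (X : Matrix H H ℂ) : expect σ Xᴴ = expect σ X := by
  change (Xᴴ * σ).trace.re = (X * σ).trace.re
  have : (Xᴴ * σ).trace = Star.star (X * σ).trace := by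
    rw [← Matrix.trace_conjTranspose, Matrix.conjTranspose_mul, hσ.1.eq, Matrix.trace_mul_comm]
  rw [this]
  simp

/-- Positivity of `(X ± Y)ᴴ (X ± Y)`, expanded; the two signs give the absolute value. -/
lemma two_mul_abs_expect_le {H : Type} [Fintype H] {σ : Matrix H H ℂ} (hσ : σ.PosSemidef)
    (X Y : Matrix H H ℂ) :
    2 * |expect σ (Xᴴ * Y)| ≤ expect σ (Xᴴ * X) + expect σ (Yᴴ * Y) := by
  have h : expect σ (Yᴴ * X) = expect σ (Xᴴ * Y) := by
    rw [← expect_conjTranspose hσ, Matrix.conjTranspose_mul, Matrix.conjTranspose_conjTranspose]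
  have h1 := expect_conjTranspose_mul_self_nonneg hσ (X - Y)
  have h2 := expect_conjTranspose_mul_self_nonneg hσ (X + Y)
  simp only [Matrix.conjTranspose_sub, Matrix.conjTranspose_add, add_mul, sub_mul, mul_add,
    mul_sub, map_add, map_sub, h] at h1 h2
  cases abs_cases (expect σ (Xᴴ * Y)) <;> linarith

/-- Nonnegativity of the variance, that is, of the expectation of `(X - ⟨X⟩)ᴴ (X - ⟨X⟩)`. -/
lemma expect_sq_le {H : Type} [Fintype H] [DecidableEq H] {σ : Matrix H H ℂ} (hσ : σ.PosSemidef)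
    (h1 : expect σ 1 = 1) (X : Matrix H H ℂ) : expect σ X ^ 2 ≤ expect σ (Xᴴ * X) := by
  have h := expect_conjTranspose_mul_self_nonneg hσ (X - (expect σ X) • (1 : Matrix H H ℂ))
  simp only [Matrix.conjTranspose_sub, sub_mul, mul_sub, map_sub, Matrix.conjTranspose_smul,
    Matrix.conjTranspose_one, Matrix.smul_mul, Matrix.mul_smul, mul_one, one_mul, map_smul, h1,
    expect_conjTranspose hσ, smul_eq_mul, star_trivial] at h
  nlinarith

/-! ### The joint state and expectations at a single node -/

namespace Network

variable {n m : ℕ} {Q : Type} [Fintype Q] [DecidableEq Q]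

lemma netState_posSemidef (N : Network n m Q) (ρ : ∀ i, DensityMatrix (N.SourceBasis i)) :
    (N.netState ρ).PosSemidef :=
  fiberProd_posSemidef N.source fun i => (ρ i).posSemidef

lemma expect_netState_one (N : Network n m Q) (ρ : ∀ i, DensityMatrix (N.SourceBasis i)) :
    expect (N.netState ρ) 1 = 1 := by
  change (1 * N.netState ρ).trace.re = 1
  have h : (N.netState ρ).trace = ∏ i, (ρ i).val.trace := trace_fiberProd N.source _
  simp [h, (ρ _).trace_eq_one]

lemma netOperator_mul (N : Network n m Q)
    (E F : ∀ j, Matrix (N.NodeBasis j) (N.NodeBasis j) ℂ) :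
    N.netOperator E * N.netOperator F = N.netOperator (fun j => E j * F j) :=
  fiberProd_mul N.node E F

omit [Fintype Q] [DecidableEq Q] in
lemma netOperator_conjTranspose (N : Network n m Q)
    (E : ∀ j, Matrix (N.NodeBasis j) (N.NodeBasis j) ℂ) :
    (N.netOperator E)ᴴ = N.netOperator (fun j => (E j)ᴴ) :=
  fiberProd_conjTranspose N.node E

/-- The expectation value of the operator `E` on the qubits of node `j`. -/
noncomputable def nodeExpect (N : Network n m Q) (ρ : ∀ i, DensityMatrix (N.SourceBasis i))
    (j : Fin m) (E : Matrix (N.NodeBasis j) (N.NodeBasis j) ℂ) : ℝ :=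
  expect (N.netState ρ) (N.netOperator (Function.update (fun _ => 1) j E))

lemma nodeExpect_one (N : Network n m Q) (ρ : ∀ i, DensityMatrix (N.SourceBasis i)) (j : Fin m) :
    N.nodeExpect ρ j 1 = 1 := by
  have h : N.netOperator (Function.update (fun _ => 1) j 1) = 1 := by
    rw [Function.update_eq_self_iff.mpr rfl]
    exact fiberProd_one N.node
  rw [nodeExpect, h, expect_netState_one]

lemma nodeExpect_add (N : Network n m Q) (ρ : ∀ i, DensityMatrix (N.SourceBasis i)) (j : Fin m)
    (E F : Matrix (N.NodeBasis j) (N.NodeBasis j) ℂ) :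
    N.nodeExpect ρ j (E + F) = N.nodeExpect ρ j E + N.nodeExpect ρ j F := by
  rw [nodeExpect, nodeExpect, nodeExpect, ← map_add]
  exact congrArg _ (fiberProd_update_add N.node j _ E F)

lemma nodeExpect_nonneg (N : Network n m Q) (ρ : ∀ i, DensityMatrix (N.SourceBasis i)) (j : Fin m)
    (E : Matrix (N.NodeBasis j) (N.NodeBasis j) ℂ) : 0 ≤ N.nodeExpect ρ j (Eᴴ * E) := by
  have h := expect_conjTranspose_mul_self_nonneg (N.netState_posSemidef ρ)
    (N.netOperator (Function.update (fun _ => 1) j E))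
  rw [netOperator_conjTranspose, netOperator_mul] at h
  convert h using 3
  rw [nodeExpect]
  congr 2
  funext i
  rcases eq_or_ne i j with rfl | hij
  · simp
  · simp [hij]

end Network

/-! ### Correlators under noise and by the Born rule -/

/-- The uniform part of the noise has mean zero; only the identity part transmits `b`. -/
lemma sum_units_mul_whiteNoise (γ : ℝ) (b : ℤˣ) :
    ∑ a : ℤˣ, ((a : ℤ) : ℝ) * whiteNoise γ a b = (1 - γ) * ((b : ℤ) : ℝ) := by
  rw [UnitsInt.univ, Finset.sum_pair (by decide)]
  rcases Int.units_eq_one_or b with rfl | rfl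
  · have h : (-1 : ℤˣ) ≠ 1 := by decide
    simp [whiteNoise, h]
  · have h : (1 : ℤˣ) ≠ -1 := by decide
    simp [whiteNoise, h]

lemma correlator_netWhiteNoise_mul {m : ℕ} (γ : Fin m → ℝ) (P : Behavior m) (x : Fin m → Fin 2) :
    correlator (netWhiteNoise γ * P) x = (∏ j, (1 - γ j)) * correlator P x := by
  simp only [correlator, Matrix.mul_apply, Finset.mul_sum]
  rw [Finset.sum_comm]
  refine Finset.sum_congr rfl fun b _ => ?_
  have h : ∑ a : Fin m → ℤˣ, ∏ j, (((a j : ℤ) : ℝ) * whiteNoise (γ j) (a j) (b j)) =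
      ∏ j, ((1 - γ j) * ((b j : ℤ) : ℝ)) := by
    simp_rw [← sum_units_mul_whiteNoise]
    rw [Finset.prod_univ_sum, Fintype.piFinset_univ]
  rw [← mul_assoc, ← Finset.prod_mul_distrib, ← h, Finset.sum_mul]
  refine Finset.sum_congr rfl fun a _ => ?_
  rw [Finset.prod_mul_distrib, netWhiteNoise, Matrix.of_apply, mul_assoc]

lemma correlator_bornBehavior {n m : ℕ} {Q : Type} [Fintype Q] [DecidableEq Q]
    (N : Network n m Q) (ρ : ∀ i, DensityMatrix (N.SourceBasis i))
    (M : ∀ j, Fin 2 → PVM ℤˣ (N.NodeBasis j)) (x : Fin m → Fin 2) :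
    correlator (N.bornBehavior ρ M) x =
      expect (N.netState ρ) (N.netOperator fun j => (M j (x j)).obs) := by
  have h : N.netOperator (fun j => (M j (x j)).obs) =
      ∑ b : Fin m → ℤˣ, (∏ j, ((b j : ℤ) : ℝ)) •
        N.netOperator fun j => (M j (x j)).proj (b j) := by
    simp_rw [← PVM.sum_smul_proj]
    refine (fiberProd_sum N.node _).trans (Finset.sum_congr rfl fun b _ => ?_)
    refine (fiberProd_smul N.node _ _).trans ?_
    ext s t
    simp [fiberProd, Network.netOperator]
  rw [h, map_sum]
  simp only [map_smul]
  rfl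

/-! ### Score quantities as expectations of product operators -/

section Scores

variable {n : ℕ}

/-- The operator whose expectation value is the noiseless `I_y` of the star. -/
noncomputable def starOp (M : ∀ j, Fin 2 → PVM ℤˣ ((star n).NodeBasis j)) (y : Fin 2) :
    ∀ j, Matrix ((star n).NodeBasis j) ((star n).NodeBasis j) ℂ :=
  fun j => if j = Fin.last n then (M j y).obs else endCombo (M j) y

/-- The operator whose expectation value is the noiseless `J_y` of the chain. -/
noncomputable def chainOp (M : ∀ j, Fin 2 → PVM ℤˣ ((chain n).NodeBasis j)) (y : Fin 2) :
    ∀ j, Matrix ((chain n).NodeBasis j) ((chain n).NodeBasis j) ℂ :=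
  fun j => if j = 0 ∨ j = Fin.last n then endCombo (M j) y else (M j y).obs

/-- The sign and the weight `2⁻ⁿ` split over the exterior nodes, so the sum over `x` is an expanded
product of the `endCombo`s. -/
lemma starI_eq (γ : Fin (n + 1) → ℝ) (ρ : ∀ i, DensityMatrix ((star n).SourceBasis i))
    (M : ∀ j, Fin 2 → PVM ℤˣ ((star n).NodeBasis j)) (y : Fin 2) :
    starI (netWhiteNoise γ * (star n).bornBehavior ρ M) y = (∏ j, (1 - γ j)) *
      expect ((star n).netState ρ) ((star n).netOperator (starOp M y)) := by
  have h : (star n).netOperator (starOp M y) = (1 / 2 ^ n : ℝ) • ∑ x : Fin n → Fin 2,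
      ((-1) ^ ((y : ℕ) * ∑ j, (x j : ℕ)) : ℝ) • (star n).netOperator fun j =>
        (M j (Fin.snoc (α := fun _ => Fin 2) x y j)).obs := by
    ext s t
    simp only [Network.netOperator, starOp, Matrix.of_apply, Matrix.smul_apply, Matrix.sum_apply,
      Fin.prod_univ_castSucc, Fin.snoc_castSucc, Fin.snoc_last, if_true,
      Fin.castSucc_ne_last, if_false]
    have h1 : ∀ j : Fin n, endCombo (M j.castSucc) y (fun q => s q.1) (fun q => t q.1) =
        ∑ x : Fin 2, (1 / 2 : ℂ) * (-1) ^ ((y : ℕ) * (x : ℕ)) *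
          (M j.castSucc x).obs (fun q => s q.1) (fun q => t q.1) := fun j => by
      simp [endCombo, Fin.sum_univ_two]
      ring
    simp_rw [h1]
    rw [Finset.prod_univ_sum, Fintype.piFinset_univ, Finset.sum_mul, Finset.smul_sum]
    refine Finset.sum_congr rfl fun x _ => ?_
    simp [Finset.prod_mul_distrib, Finset.prod_pow_eq_pow_sum, Finset.mul_sum]
    ring
  rw [h, starI]
  simp only [correlator_netWhiteNoise_mul, correlator_bornBehavior, map_smul, map_sum,
    smul_eq_mul, Finset.mul_sum]
  refine Finset.sum_congr rfl fun x _ => ?_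
  ring

/-- `1 ≤ n` makes the two ends distinct nodes, each contributing one factor `1 / 2`. -/
lemma chainI_eq (hn : 1 ≤ n) (γ : Fin (n + 1) → ℝ)
    (ρ : ∀ i, DensityMatrix ((chain n).SourceBasis i))
    (M : ∀ j, Fin 2 → PVM ℤˣ ((chain n).NodeBasis j)) (y : Fin 2) :
    chainI (netWhiteNoise γ * (chain n).bornBehavior ρ M) y = (∏ j, (1 - γ j)) *
      expect ((chain n).netState ρ) ((chain n).netOperator (chainOp M y)) := by
  have h : (chain n).netOperator (chainOp M y) = (1 / 4 : ℝ) • ∑ x₁ : Fin 2, ∑ x₂ : Fin 2,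
      ((-1) ^ ((y : ℕ) * ((x₁ : ℕ) + (x₂ : ℕ))) : ℝ) • (chain n).netOperator fun j =>
        (M j (chainInput n x₁ x₂ y j)).obs := by
    obtain ⟨k, rfl⟩ : ∃ k, n = k + 1 := ⟨n - 1, by omega⟩
    ext s t
    have hm : ∀ i : Fin k, i.castSucc.succ ≠ Fin.last (k + 1) := fun i => by
      rw [← Fin.succ_last]
      exact fun h => Fin.castSucc_ne_last i (Fin.succ_injective _ h)
    have hm0 : ∀ i : Fin k, i.castSucc.succ ≠ 0 := fun i => Fin.succ_ne_zero _
    simp only [Network.netOperator, chainOp, chainInput, Matrix.of_apply, Matrix.smul_apply,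
      Matrix.sum_apply, Fin.prod_univ_succ (n := k + 1), Fin.prod_univ_castSucc (n := k), if_true,
      hm, hm0, if_false, true_or, or_true, or_self, Fin.succ_last]
    have h1 : (Fin.last (k + 1)) ≠ 0 := by simp
    simp only [h1, if_false, Fin.sum_univ_two, endCombo]
    fin_cases y <;> simp <;> ring
  rw [h, chainI]
  simp only [correlator_netWhiteNoise_mul, correlator_bornBehavior, map_smul, map_sum,
    smul_eq_mul, Finset.mul_sum]
  refine Finset.sum_congr rfl fun x₁ _ => Finset.sum_congr rfl fun x₂ _ => ?_
  ring

end Scores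

/-! ### Upper bound for the chain -/

lemma sqrt_add_sqrt_le {a b c : ℝ} (ha : 0 ≤ a) (hb : 0 ≤ b) (h : a + b ≤ c) :
    √a + √b ≤ √2 * √c := by
  rw [← Real.sqrt_mul (by norm_num)]
  refine Real.le_sqrt_of_sq_le ?_
  nlinarith [Real.sq_sqrt ha, Real.sq_sqrt hb, sq_nonneg (√a - √b)]

variable {n : ℕ}

lemma nodeExpect_endCombo {m k : ℕ} {Q : Type} [Fintype Q] [DecidableEq Q] (N : Network k m Q)
    (ρ : ∀ i, DensityMatrix (N.SourceBasis i)) (j : Fin m)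
    (M : Fin 2 → PVM ℤˣ (N.NodeBasis j)) :
    N.nodeExpect ρ j (endCombo M 0 * endCombo M 0) +
      N.nodeExpect ρ j (endCombo M 1 * endCombo M 1) = 1 := by
  rw [← Network.nodeExpect_add, endCombo_mul_self_add, Network.nodeExpect_one]

lemma abs_expect_chainOp_le (hn : 1 ≤ n) (ρ : ∀ i, DensityMatrix ((chain n).SourceBasis i))
    (M : ∀ j, Fin 2 → PVM ℤˣ ((chain n).NodeBasis j)) (y : Fin 2) :
    2 * |expect ((chain n).netState ρ) ((chain n).netOperator (chainOp M y))| ≤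
      (chain n).nodeExpect ρ 0 (endCombo (M 0) y * endCombo (M 0) y) +
      (chain n).nodeExpect ρ (Fin.last n)
        (endCombo (M (Fin.last n)) y * endCombo (M (Fin.last n)) y) := by
  have h0 : (0 : Fin (n + 1)) ≠ Fin.last n := by
    rw [Ne, Fin.ext_iff]
    simp
    omega
  have hC0 : chainOp M y 0 = endCombo (M 0) y := by simp [chainOp]
  have hC1 : chainOp M y (Fin.last n) = endCombo (M (Fin.last n)) y := by simp [chainOp]
  -- Here `X` is the first node's factor and `Y` all the others. In `Yᴴ * Y` the interior
  -- observables square to `1`, leaving only the last node.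
  have h := two_mul_abs_expect_le ((chain n).netState_posSemidef ρ)
    ((chain n).netOperator (Function.update (fun _ => 1) 0 (endCombo (M 0) y)))
    ((chain n).netOperator (Function.update (chainOp M y) 0 1))
  simp only [Network.netOperator_conjTranspose, Network.netOperator_mul] at h
  refine (le_of_eq ?_).trans (h.trans (le_of_eq ?_))
  · congr 4
    funext j
    rcases eq_or_ne j 0 with rfl | hj
    · simp [hC0, endCombo_conjTranspose]
    · simp [hj]
  · rw [Network.nodeExpect, Network.nodeExpect]
    congr 3
    · funext j
      rcases eq_or_ne j 0 with rfl | hj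
      · simp [endCombo_conjTranspose]
      · simp [hj]
    · funext j
      rcases eq_or_ne j 0 with rfl | hj
      · simp [h0]
      · rcases eq_or_ne j (Fin.last n) with rfl | hl
        · simp [hj, hC1, endCombo_conjTranspose]
        · simp [hj, hl, chainOp, PVM.obs_conjTranspose, PVM.obs_mul_self]

lemma chainScore_le (hn : 1 ≤ n) (γ : Fin (n + 1) → ℝ) (hγ : ∀ j, γ j ∈ Set.Icc (0 : ℝ) 1)
    {P : Behavior (n + 1)} (hP : P ∈ noisyQuantumSet (chain n) γ) :
    chainScore P ≤ √2 * √(∏ j, (1 - γ j)) := by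
  obtain ⟨ρ, M, rfl⟩ := hP
  have hg : 0 ≤ ∏ j, (1 - γ j) := Finset.prod_nonneg fun j _ => by linarith [(hγ j).2]
  rw [chainScore, chainI_eq hn, chainI_eq hn, abs_mul, abs_mul, abs_of_nonneg hg]
  refine sqrt_add_sqrt_le (by positivity) (by positivity) ?_
  have h0 := abs_expect_chainOp_le hn ρ M 0
  have h1 := abs_expect_chainOp_le hn ρ M 1
  have e0 := nodeExpect_endCombo (chain n) ρ 0 (M 0)
  have e1 := nodeExpect_endCombo (chain n) ρ (Fin.last n) (M (Fin.last n))
  rw [← mul_add]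
  exact mul_le_of_le_one_right hg (by linarith)

/-! ### Upper bound for the star -/

section Star

lemma star_source_eq {i : Fin n} {q : Fin n × Fin 2} (h : (star n).node q = i.castSucc) :
    (star n).source q = i := by
  by_cases hq : q.2 = 0
  · simpa [star, hq] using h
  · simp only [star, hq, if_false] at h
    exact absurd h.symm (Fin.castSucc_ne_last i)

/-- The operator `E ⊗ 𝟙` on the qubits of source `i`, with `E` acting on the qubit of the exterior
node `i`. -/
noncomputable def leafOp (i : Fin n)
    (E : Matrix ((star n).NodeBasis i.castSucc) ((star n).NodeBasis i.castSucc) ℂ) :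
    Matrix ((star n).SourceBasis i) ((star n).SourceBasis i) ℂ :=
  Matrix.of fun u v => E (fun q => u ⟨q.1, star_source_eq q.2⟩) (fun q => v ⟨q.1, star_source_eq q.2⟩) *
    if u ⟨(i, 1), rfl⟩ = v ⟨(i, 1), rfl⟩ then 1 else 0

lemma leafOp_one (i : Fin n) : leafOp i 1 = 1 := by
  ext u v
  simp only [leafOp, Matrix.of_apply, Matrix.one_apply, ← ite_and, mul_ite, mul_one, mul_zero]
  refine if_congr ⟨fun h => ?_, ?_⟩ rfl rfl
  · funext ⟨⟨i', b⟩, hq⟩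
    obtain rfl : i' = i := hq
    have hb : b = 0 ∨ b = 1 := by omega
    rcases hb with rfl | rfl
    · exact congrFun h.2 ⟨(i', 0), rfl⟩
    · exact h.1
  · rintro rfl
    exact ⟨rfl, rfl⟩

/-- With a trivial central node, no factor joins different sources, so the product over nodes can be
regrouped by source. -/
lemma star_netOperator_eq (E : ∀ j, Matrix ((star n).NodeBasis j) ((star n).NodeBasis j) ℂ)
    (hE : E (Fin.last n) = 1) :
    (star n).netOperator E = fiberProd (star n).source fun i => leafOp i (E i.castSucc) := by
  ext s t
  simp only [Network.netOperator, fiberProd, leafOp, Matrix.of_apply, Fin.prod_univ_castSucc, hE,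
    Finset.prod_mul_distrib, Matrix.one_apply]
  congr 1
  have h : ((fun q : {q // (star n).node q = Fin.last n} => s q.1) = fun q => t q.1) ↔
      ∀ i ∈ (Finset.univ : Finset (Fin n)), s (i, 1) = t (i, 1) := by
    refine ⟨fun h i _ => ?_, fun h => ?_⟩
    · exact congrFun h ⟨(i, 1), rfl⟩
    · funext ⟨⟨i, b⟩, hq⟩
      have hb : b = 1 := by
        by_contra hb
        have hb : b = 0 := by omega
        subst hb
        exact Fin.castSucc_ne_last i hq
      subst hb
      exact h i (Finset.mem_univ _)
  rw [Finset.prod_ite_zero, Finset.prod_const_one]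
  by_cases hst : ∀ i ∈ (Finset.univ : Finset (Fin n)), s (i, 1) = t (i, 1)
  · rw [if_pos (h.mpr hst), if_pos hst]
  · rw [if_neg (mt h.mp hst), if_neg hst]

lemma star_trace_netOperator_mul (ρ : ∀ i, DensityMatrix ((star n).SourceBasis i))
    (E : ∀ j, Matrix ((star n).NodeBasis j) ((star n).NodeBasis j) ℂ)
    (hE : E (Fin.last n) = 1) :
    ((star n).netOperator E * (star n).netState ρ).trace =
      ∏ i : Fin n, (leafOp i (E i.castSucc) * (ρ i).val).trace := by
  rw [star_netOperator_eq E hE, ← trace_fiberProd, ← fiberProd_mul]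
  rfl

lemma trace_leafOp_mul_eq (ρ : ∀ i, DensityMatrix ((star n).SourceBasis i)) (i : Fin n)
    (E : Matrix ((star n).NodeBasis i.castSucc) ((star n).NodeBasis i.castSucc) ℂ) :
    (leafOp i E * (ρ i).val).trace =
      ((star n).netOperator (Function.update (fun _ => 1) i.castSucc E) *
        (star n).netState ρ).trace := by
  rw [star_trace_netOperator_mul]
  · rw [Finset.prod_eq_single i]
    · simp
    · intro k _ hk
      rw [Function.update_of_ne (by simpa using hk), leafOp_one, one_mul, (ρ k).trace_eq_one]
    · simp
  · rw [Function.update_of_ne (Fin.castSucc_ne_last i).symm]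

/-- Real parts do not multiply. Self-adjointness makes each trace real, so that the product of
traces is the product of the expectations. -/
lemma trace_leafOp_mul (ρ : ∀ i, DensityMatrix ((star n).SourceBasis i)) (i : Fin n)
    (E : Matrix ((star n).NodeBasis i.castSucc) ((star n).NodeBasis i.castSucc) ℂ)
    (hE : Eᴴ = E) :
    (leafOp i E * (ρ i).val).trace = ((star n).nodeExpect ρ i.castSucc E : ℂ) := by
  rw [trace_leafOp_mul_eq]
  set X := (star n).netOperator (Function.update (fun _ => 1) i.castSucc E) with hX
  have hXX : Xᴴ = X := by
    rw [hX, Network.netOperator_conjTranspose]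
    congr 1
    funext j
    rcases eq_or_ne j i.castSucc with rfl | hj
    · simp [hE]
    · simp [hj]
  have h : Star.star (X * (star n).netState ρ).trace = (X * (star n).netState ρ).trace := by
    rw [← Matrix.trace_conjTranspose, Matrix.conjTranspose_mul, hXX,
      ((star n).netState_posSemidef ρ).1.eq, Matrix.trace_mul_comm]
  exact (Complex.conj_eq_iff_re.mp h).symm

/-- Squaring turns the central observable into `1`; this is what lets the product state factor the
expectation. -/
lemma expect_starOp_sq_le (ρ : ∀ i, DensityMatrix ((star n).SourceBasis i))
    (M : ∀ j, Fin 2 → PVM ℤˣ ((star n).NodeBasis j)) (y : Fin 2) :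
    expect ((star n).netState ρ) ((star n).netOperator (starOp M y)) ^ 2 ≤
      ∏ i : Fin n, (star n).nodeExpect ρ i.castSucc
        (endCombo (M i.castSucc) y * endCombo (M i.castSucc) y) := by
  refine (expect_sq_le ((star n).netState_posSemidef ρ) ((star n).expect_netState_one ρ) _).trans
    (le_of_eq ?_)
  rw [Network.netOperator_conjTranspose, Network.netOperator_mul]
  change (Matrix.trace (_ * (star n).netState ρ) : ℂ).re = _
  rw [star_trace_netOperator_mul]
  · have h : ∀ i : Fin n, starOp M y i.castSucc = endCombo (M i.castSucc) y := fun i => by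
      simp [starOp]
    simp_rw [h, endCombo_conjTranspose]
    have h2 : ∀ i : Fin n, (leafOp i (endCombo (M i.castSucc) y * endCombo (M i.castSucc) y) *
        (ρ i).val).trace = ((star n).nodeExpect ρ i.castSucc
          (endCombo (M i.castSucc) y * endCombo (M i.castSucc) y) : ℂ) := fun i =>
      trace_leafOp_mul ρ i _ (by rw [Matrix.conjTranspose_mul, endCombo_conjTranspose])
    rw [Finset.prod_congr rfl fun i _ => h2 i, ← Complex.ofReal_prod, Complex.ofReal_re]
  · simp [starOp, PVM.obs_conjTranspose, PVM.obs_mul_self]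

lemma abs_rpow_le_average (hn : 1 ≤ n) {c : Fin n → ℝ} (hc : ∀ i, 0 ≤ c i) {r : ℝ}
    (h : r ^ 2 ≤ ∏ i, c i) : |r| ^ (1 / (n : ℝ)) ≤ ∑ i, 1 / (n : ℝ) * √(c i) := by
  have hn' : (n : ℝ) ≠ 0 := by positivity
  have h1 : |r| ≤ ∏ i, √(c i) := by
    refine abs_le_of_sq_le_sq ?_ (Finset.prod_nonneg fun _ _ => Real.sqrt_nonneg _)
    rw [← Finset.prod_pow]
    simpa [Real.sq_sqrt (hc _)] using h
  calc |r| ^ (1 / (n : ℝ)) ≤ (∏ i, √(c i)) ^ (1 / (n : ℝ)) :=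
        Real.rpow_le_rpow (abs_nonneg r) h1 (by positivity)
    _ = ∏ i, √(c i) ^ (1 / (n : ℝ)) :=
        (Real.finsetProd_rpow _ _ (fun _ _ => Real.sqrt_nonneg _) _).symm
    _ ≤ ∑ i, 1 / (n : ℝ) * √(c i) :=
        Real.geom_mean_le_arith_mean_weighted _ _ _ (fun _ _ => by positivity)
          (by simp [hn']) fun _ _ => Real.sqrt_nonneg _

lemma starScore_le (hn : 1 ≤ n) (γ : Fin (n + 1) → ℝ) (hγ : ∀ j, γ j ∈ Set.Icc (0 : ℝ) 1)
    {P : Behavior (n + 1)} (hP : P ∈ noisyQuantumSet (star n) γ) :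
    starScore P ≤ √2 * (∏ j, (1 - γ j)) ^ (1 / (n : ℝ)) := by
  obtain ⟨ρ, M, rfl⟩ := hP
  have hn' : (n : ℝ) ≠ 0 := by positivity
  have hg : 0 ≤ ∏ j, (1 - γ j) := Finset.prod_nonneg fun j _ => by linarith [(hγ j).2]
  have hc : ∀ y (i : Fin n), 0 ≤ (star n).nodeExpect ρ i.castSucc
      (endCombo (M i.castSucc) y * endCombo (M i.castSucc) y) := fun y i => by
    simpa [endCombo_conjTranspose] using
      (star n).nodeExpect_nonneg ρ i.castSucc (endCombo (M i.castSucc) y)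
  have h0 := abs_rpow_le_average hn (hc 0) (expect_starOp_sq_le ρ M 0)
  have h1 := abs_rpow_le_average hn (hc 1) (expect_starOp_sq_le ρ M 1)
  rw [starScore, starI_eq, starI_eq, abs_mul, abs_mul, abs_of_nonneg hg,
    Real.mul_rpow hg (abs_nonneg _), Real.mul_rpow hg (abs_nonneg _), ← mul_add, mul_comm (√2)]
  refine mul_le_mul_of_nonneg_left ((add_le_add h0 h1).trans ?_) (by positivity)
  rw [← Finset.sum_add_distrib]
  calc _ ≤ ∑ i : Fin n, 1 / (n : ℝ) * √2 := Finset.sum_le_sum fun i _ => by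
        rw [← mul_add]
        refine mul_le_mul_of_nonneg_left ?_ (by positivity)
        simpa using sqrt_add_sqrt_le (hc 0 i) (hc 1 i)
          (nodeExpect_endCombo (star n) ρ i.castSucc (M i.castSucc)).le
    _ = √2 := by simp [hn']

end Star

/-! ### The optimal strategy: Pauli measurements on Bell states -/

section TensorPow

variable (T : Type) [Fintype T]

/-- The operator `p ⊗ ⋯ ⊗ p` on the qubits `T`. -/
def tensorPow (p : Matrix (Fin 2) (Fin 2) ℂ) : Matrix (T → Fin 2) (T → Fin 2) ℂ :=
  Matrix.of fun s t => ∏ q, p (s q) (t q)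

lemma tensorPow_mul [DecidableEq T] (p r : Matrix (Fin 2) (Fin 2) ℂ) :
    tensorPow T p * tensorPow T r = tensorPow T (p * r) := by
  ext s t
  simp only [tensorPow, Matrix.mul_apply, Matrix.of_apply, ← Finset.prod_mul_distrib]
  rw [Finset.prod_univ_sum, Fintype.piFinset_univ]

lemma tensorPow_one [DecidableEq T] : tensorPow T 1 = 1 := by
  ext s t
  simp only [tensorPow, Matrix.of_apply, Matrix.one_apply]
  rw [Finset.prod_ite_zero, Finset.prod_const_one]
  simp only [Finset.mem_univ, forall_const, funext_iff]

lemma tensorPow_neg (p : Matrix (Fin 2) (Fin 2) ℂ) :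
    tensorPow T (-p) = (-1 : ℂ) ^ Fintype.card T • tensorPow T p := by
  ext s t
  simp [tensorPow, Finset.prod_neg]

lemma tensorPow_conjTranspose (p : Matrix (Fin 2) (Fin 2) ℂ) :
    (tensorPow T p)ᴴ = tensorPow T pᴴ := by
  ext s t
  simp [tensorPow, Matrix.conjTranspose_apply]

lemma tensorPow_eq_fiberProd {k : ℕ} (f : T → Fin k) (p : Matrix (Fin 2) (Fin 2) ℂ) :
    tensorPow T p = fiberProd f fun i => tensorPow {q // f q = i} p := by
  ext s t
  simp only [tensorPow, fiberProd, Matrix.of_apply]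
  exact (Fintype.prod_fiberwise f fun q => p (s q) (t q)).symm

/-- The Pauli matrices `Z` and `X`. -/
def pauli (y : Fin 2) : Matrix (Fin 2) (Fin 2) ℂ :=
  if y = 0 then !![1, 0; 0, -1] else !![0, 1; 1, 0]

lemma pauli_conjTranspose (y : Fin 2) : (pauli y)ᴴ = pauli y := by
  ext i j
  fin_cases y <;> fin_cases i <;> fin_cases j <;> simp [pauli]

lemma pauli_mul_self (y : Fin 2) : pauli y * pauli y = 1 := by
  fin_cases y <;> simp [pauli, Matrix.one_fin_two]

lemma pauli_one_mul_pauli_zero : pauli 1 * pauli 0 = -(pauli 0 * pauli 1) := by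
  simp [pauli]

/-- The measurement of a `±1`-valued observable. -/
noncomputable def PVM.ofObs {H : Type} [Fintype H] [DecidableEq H] (A : Matrix H H ℂ)
    (hA : Aᴴ = A) (hA2 : A * A = 1) : PVM ℤˣ H where
  proj b := (1 / 2 : ℂ) • (1 + ((b : ℤ) : ℂ) • A)
  isStarProjection b := by
    constructor
    · rw [IsIdempotentElem]
      rcases Int.units_eq_one_or b with rfl | rfl <;>
      · simp only [Matrix.smul_mul, Matrix.mul_smul, mul_add, add_mul, hA2, mul_one, one_mul]
        push_cast
        module
    · rw [IsSelfAdjoint, Matrix.star_eq_conjTranspose]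
      simp [hA]
  orthogonal a b hab := by
    obtain rfl : b = -a := by
      rcases Int.units_eq_one_or a with rfl | rfl <;>
        rcases Int.units_eq_one_or b with rfl | rfl <;> simp_all
    rcases Int.units_eq_one_or a with rfl | rfl <;>
    · simp only [Matrix.smul_mul, Matrix.mul_smul, mul_add, add_mul, hA2, mul_one, one_mul]
      push_cast
      module
  sum_eq_one := by
    rw [UnitsInt.univ, Finset.sum_pair (by decide)]
    push_cast
    module

lemma PVM.obs_ofObs {H : Type} [Fintype H] [DecidableEq H] (A : Matrix H H ℂ)
    (hA : Aᴴ = A) (hA2 : A * A = 1) : (PVM.ofObs A hA hA2).obs = A := by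
  simp only [PVM.obs, PVM.ofObs]
  push_cast
  module

/-- The measurement of `Z ⊗ ⋯ ⊗ Z` or `X ⊗ ⋯ ⊗ X`. -/
noncomputable def pauliPVM [DecidableEq T] (y : Fin 2) : PVM ℤˣ (T → Fin 2) :=
  PVM.ofObs (tensorPow T (pauli y)) (by rw [tensorPow_conjTranspose, pauli_conjTranspose])
    (by rw [tensorPow_mul, pauli_mul_self, tensorPow_one])

/-- The measurement of `(Z ± X) / √2` on a single qubit. -/
noncomputable def tiltedPVM [DecidableEq T] (hT : Fintype.card T = 1) (x : Fin 2) :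
    PVM ℤˣ (T → Fin 2) :=
  PVM.ofObs (((1 / √2 : ℝ) : ℂ) • (tensorPow T (pauli 0) + (-1 : ℂ) ^ (x : ℕ) • tensorPow T (pauli 1)))
    (by
      simp only [Matrix.conjTranspose_smul, Matrix.conjTranspose_add, tensorPow_conjTranspose,
        pauli_conjTranspose]
      simp)
    (by
      have h2 : ((1 / √2 : ℝ) : ℂ) * ((1 / √2 : ℝ) : ℂ) = 1 / 2 := by
        rw [← Complex.ofReal_mul, div_mul_div_comm, Real.mul_self_sqrt (by norm_num)]
        norm_num
      have hx : (-1 : ℂ) ^ (x : ℕ) * (-1 : ℂ) ^ (x : ℕ) = 1 := by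
        rw [← mul_pow]
        simp
      -- Anticommutation needs `hT`: on `T` the sign is `(-1) ^ card T`.
      have hA : tensorPow T (pauli 1) * tensorPow T (pauli 0) =
          -(tensorPow T (pauli 0) * tensorPow T (pauli 1)) := by
        rw [tensorPow_mul, tensorPow_mul, pauli_one_mul_pauli_zero, tensorPow_neg, hT]
        simp
      have hs : ∀ y, tensorPow T (pauli y) * tensorPow T (pauli y) = 1 := fun y => by
        rw [tensorPow_mul, pauli_mul_self, tensorPow_one]
      rw [smul_mul_smul_comm, h2]
      simp only [Matrix.smul_mul, Matrix.mul_smul, mul_add, add_mul, hs, hA, smul_smul, hx]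
      module)

lemma endCombo_tiltedPVM [DecidableEq T] (hT : Fintype.card T = 1) (y : Fin 2) :
    endCombo (tiltedPVM T hT) y = ((1 / √2 : ℝ) : ℂ) • tensorPow T (pauli y) := by
  simp only [endCombo, tiltedPVM, PVM.obs_ofObs]
  fin_cases y <;> simp <;> module

/-- The (unnormalized) vector `|0⋯0⟩ + |1⋯1⟩`. -/
noncomputable def ghzVec [DecidableEq T] : (T → Fin 2) → ℂ :=
  ∑ a : Fin 2, Pi.single (fun _ => a) 1

lemma trace_tensorPow_mul_ghz [DecidableEq T] (p : Matrix (Fin 2) (Fin 2) ℂ) :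
    (tensorPow T p * ((1 / 2 : ℂ) • Matrix.vecMulVec (ghzVec T) (Star.star (ghzVec T)))).trace =
      1 / 2 * ∑ a : Fin 2, ∑ b : Fin 2, p a b ^ Fintype.card T := by
  have h : Star.star (ghzVec T) = ghzVec T := by
    simp [ghzVec]
  rw [h, Matrix.mul_smul, Matrix.trace_smul, Matrix.mul_vecMulVec, Matrix.trace_vecMulVec,
    smul_eq_mul]
  congr 1
  simp [ghzVec, Matrix.mulVec_add, tensorPow]

/-- The state `(|0⋯0⟩ + |1⋯1⟩) / √2`; on two qubits, the Bell state. -/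
noncomputable def ghzState [DecidableEq T] (hT : Fintype.card T ≠ 0) : DensityMatrix (T → Fin 2) where
  val := (1 / 2 : ℂ) • Matrix.vecMulVec (ghzVec T) (Star.star (ghzVec T))
  posSemidef := (Matrix.posSemidef_vecMulVec_self_star _).smul (by simp)
  trace_eq_one := by
    have h := trace_tensorPow_mul_ghz T 1
    rw [tensorPow_one, one_mul] at h
    rw [h]
    simp [Fin.sum_univ_two, hT]
    norm_num

/-- The squared entries of `Z`, and likewise of `X`, sum to `2`: the Bell state is fixed by `Z ⊗ Z`
and `X ⊗ X`. -/
lemma trace_pauli_mul_ghzState [DecidableEq T] (hT : Fintype.card T = 2) (y : Fin 2) :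
    (tensorPow T (pauli y) * (ghzState T (by omega)).val).trace = 1 := by
  rw [ghzState, trace_tensorPow_mul_ghz, hT]
  fin_cases y <;> simp [pauli] <;> norm_num

end TensorPow

/-- The same Pauli acts on every qubit, so its tensor power over nodes is also one over sources,
where each Bell pair gives `1`. -/
lemma expect_tensorPow_pauli {n m : ℕ} {Q : Type} [Fintype Q] [DecidableEq Q] (N : Network n m Q)
    (hN : ∀ i, Fintype.card {q // N.source q = i} = 2) (y : Fin 2) (c : Fin m → ℝ) :
    expect (N.netState fun i => ghzState _ (by rw [hN i]; norm_num))
      (N.netOperator fun j => ((c j : ℝ) : ℂ) • tensorPow {q // N.node q = j} (pauli y)) =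
        ∏ j, c j := by
  have h : N.netOperator (fun j => ((c j : ℝ) : ℂ) • tensorPow {q // N.node q = j} (pauli y)) =
      (∏ j, c j) • tensorPow Q (pauli y) := by
    refine (fiberProd_smul N.node _ _).trans ?_
    rw [tensorPow_eq_fiberProd Q N.node, ← Complex.ofReal_prod]
    rfl
  rw [h, map_smul, tensorPow_eq_fiberProd Q N.source]
  have h1 : (fiberProd N.source (fun i => tensorPow {q // N.source q = i} (pauli y)) *
      fiberProd N.source fun i => (ghzState {q // N.source q = i} (by rw [hN i]; norm_num)).val).trace
      = 1 := by
    rw [fiberProd_mul, trace_fiberProd]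
    exact Finset.prod_eq_one fun i _ => trace_pauli_mul_ghzState _ (hN i) y
  have h2 : expect (N.netState fun i => ghzState _ (by rw [hN i]; norm_num))
      (fiberProd N.source (fun i => tensorPow {q // N.source q = i} (pauli y))) = 1 :=
    (congrArg Complex.re h1).trans Complex.one_re
  rw [h2, smul_eq_mul, mul_one]

open Classical in
/-- The measurements of the nodes: `(Z ± X) / √2` at the nodes with `e j` that hold one qubit, and
`Z ⊗ ⋯ ⊗ Z`, `X ⊗ ⋯ ⊗ X` at the others. -/
noncomputable def bellPVM {n m : ℕ} {Q : Type} [Fintype Q] [DecidableEq Q] (N : Network n m Q)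
    (e : Fin m → Prop) (j : Fin m) (x : Fin 2) : PVM ℤˣ (N.NodeBasis j) :=
  -- The cardinality test only supplies the argument of `tiltedPVM`; it succeeds at every marked
  -- node of the star and the chain.
  if h : Fintype.card {q // N.node q = j} = 1 ∧ e j then tiltedPVM _ h.1 x else pauliPVM _ x

lemma bellPVM_of_not {n m : ℕ} {Q : Type} [Fintype Q] [DecidableEq Q] {N : Network n m Q}
    {e : Fin m → Prop} {j : Fin m} (h : ¬ e j) (x : Fin 2) :
    (bellPVM N e j x).obs = tensorPow _ (pauli x) := by
  rw [bellPVM, dif_neg fun h' => h h'.2, pauliPVM, PVM.obs_ofObs]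

lemma endCombo_bellPVM {n m : ℕ} {Q : Type} [Fintype Q] [DecidableEq Q] {N : Network n m Q}
    {e : Fin m → Prop} {j : Fin m} (hj : Fintype.card {q // N.node q = j} = 1) (h : e j)
    (y : Fin 2) :
    endCombo (bellPVM N e j) y = ((1 / √2 : ℝ) : ℂ) • tensorPow _ (pauli y) := by
  have : bellPVM N e j = tiltedPVM _ hj := by
    funext x
    rw [bellPVM, dif_pos ⟨hj, h⟩]
  rw [this, endCombo_tiltedPVM]

lemma card_fst_fiber {n : ℕ} (i : Fin n) :
    Fintype.card {q : Fin n × Fin 2 // q.1 = i} = 2 := by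
  have e : {q : Fin n × Fin 2 // q.1 = i} ≃ Fin 2 :=
    { toFun := fun q => q.1.2
      invFun := fun b => ⟨(i, b), rfl⟩
      left_inv := by
        rintro ⟨⟨i', b⟩, rfl⟩
        rfl
      right_inv := fun _ => rfl }
  simpa using Fintype.card_congr e

/-! ### Attainment of the bounds -/

variable {n : ℕ}

lemma card_star_node (i : Fin n) :
    Fintype.card {q // (star n).node q = i.castSucc} = 1 := by
  refine Fintype.card_eq_one_iff.mpr ⟨⟨(i, 0), rfl⟩, ?_⟩
  rintro ⟨⟨i', b⟩, hq⟩
  by_cases hb : b = 0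
  · subst hb
    obtain rfl := Fin.castSucc_injective _ hq
    rfl
  · simp only [star, hb, if_false] at hq
    exact absurd hq.symm (Fin.castSucc_ne_last i)

lemma card_chain_node (hn : 1 ≤ n) (j : Fin (n + 1)) (hj : j = 0 ∨ j = Fin.last n) :
    Fintype.card {q // (chain n).node q = j} = 1 := by
  obtain ⟨k, rfl⟩ : ∃ k, n = k + 1 := ⟨n - 1, by omega⟩
  rcases hj with rfl | rfl
  · refine Fintype.card_eq_one_iff.mpr ⟨⟨(0, 0), rfl⟩, ?_⟩
    rintro ⟨⟨i', b⟩, hq⟩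
    by_cases hb : b = 0
    · subst hb
      obtain rfl : i' = 0 := Fin.castSucc_injective _ hq
      rfl
    · simp [chain, hb] at hq
  · refine Fintype.card_eq_one_iff.mpr ⟨⟨(Fin.last k, 1), rfl⟩, ?_⟩
    rintro ⟨⟨i', b⟩, hq⟩
    by_cases hb : b = 0
    · simp only [chain, hb, if_true] at hq
      exact absurd hq (Fin.castSucc_ne_last i')
    · obtain rfl : b = 1 := by omega
      simp only [chain, one_ne_zero, if_false, ← Fin.succ_last] at hq
      obtain rfl := Fin.succ_injective _ hq
      rfl

lemma exists_starScore_eq (hn : 1 ≤ n) (γ : Fin (n + 1) → ℝ)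
    (hγ : ∀ j, γ j ∈ Set.Icc (0 : ℝ) 1) :
    ∃ P ∈ noisyQuantumSet (star n) γ, starScore P = √2 * (∏ j, (1 - γ j)) ^ (1 / (n : ℝ)) := by
  have hg : 0 ≤ ∏ j, (1 - γ j) := Finset.prod_nonneg fun j _ => by linarith [(hγ j).2]
  have hs : ∀ i, Fintype.card {q // (star n).source q = i} = 2 := card_fst_fiber
  refine ⟨_, ⟨fun i => ghzState _ (by rw [hs i]; norm_num),
    bellPVM (star n) (· ≠ Fin.last n), rfl⟩, ?_⟩
  have h : ∀ y, starOp (bellPVM (star n) (· ≠ Fin.last n)) y = fun j =>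
      ((if j = Fin.last n then 1 else 1 / √2 : ℝ) : ℂ) •
        tensorPow {q // (star n).node q = j} (pauli y) := fun y => by
    funext j
    by_cases hj : j = Fin.last n
    · rw [starOp, if_pos hj, bellPVM_of_not (not_not.mpr hj), if_pos hj, Complex.ofReal_one,
        one_smul]
    · obtain ⟨i, rfl⟩ := Fin.exists_castSucc_eq.mpr hj
      rw [starOp, if_neg hj, if_neg hj]
      exact endCombo_bellPVM (card_star_node i) hj y
  -- Each of the `n` exterior nodes contributes `1 / √2` to `I_y`, for both `y`.
  have hr : ((1 / √2 : ℝ) ^ n) ^ (1 / (n : ℝ)) = 1 / √2 := by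
    rw [one_div (n : ℝ)]
    exact Real.pow_rpow_inv_natCast (by positivity) (by omega)
  rw [starScore, starI_eq, starI_eq, h, h, expect_tensorPow_pauli _ hs,
    expect_tensorPow_pauli _ hs]
  simp only [Fin.prod_univ_castSucc (fun j => if j = Fin.last n then (1 : ℝ) else 1 / √2),
    Fin.castSucc_ne_last, if_true, if_false, Finset.prod_const, Finset.card_univ,
    Fintype.card_fin, mul_one]
  rw [abs_of_nonneg (by positivity), Real.mul_rpow hg (by positivity), hr, ← mul_add, mul_comm,
    ← add_div, one_add_one_eq_two, Real.div_sqrt]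

lemma exists_chainScore_eq (hn : 1 ≤ n) (γ : Fin (n + 1) → ℝ)
    (hγ : ∀ j, γ j ∈ Set.Icc (0 : ℝ) 1) :
    ∃ P ∈ noisyQuantumSet (chain n) γ, chainScore P = √2 * √(∏ j, (1 - γ j)) := by
  have hg : 0 ≤ ∏ j, (1 - γ j) := Finset.prod_nonneg fun j _ => by linarith [(hγ j).2]
  have hs : ∀ i, Fintype.card {q // (chain n).source q = i} = 2 := card_fst_fiber
  refine ⟨_, ⟨fun i => ghzState _ (by rw [hs i]; norm_num),
    bellPVM (chain n) (fun j => j = 0 ∨ j = Fin.last n), rfl⟩, ?_⟩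
  have h : ∀ y, chainOp (bellPVM (chain n) (fun j => j = 0 ∨ j = Fin.last n)) y = fun j =>
      ((if j = 0 ∨ j = Fin.last n then 1 / √2 else 1 : ℝ) : ℂ) •
        tensorPow {q // (chain n).node q = j} (pauli y) := fun y => by
    funext j
    by_cases hj : j = 0 ∨ j = Fin.last n
    · rw [chainOp, if_pos hj, if_pos hj]
      exact endCombo_bellPVM (card_chain_node hn j hj) hj y
    · rw [chainOp, if_neg hj, bellPVM_of_not hj, if_neg hj, Complex.ofReal_one, one_smul]
  -- Only the two ends contribute, so both `J_y` have noiseless value `1 / 2`.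
  have hp : ∏ j : Fin (n + 1), (if j = 0 ∨ j = Fin.last n then 1 / √2 else 1 : ℝ) = 1 / 2 := by
    have h0 : (0 : Fin (n + 1)) ≠ Fin.last n := by
      rw [Ne, Fin.ext_iff]
      simp
      omega
    have hf : Finset.univ.filter (fun j : Fin (n + 1) => j = 0 ∨ j = Fin.last n) =
        {0, Fin.last n} := by
      ext j
      simp
    rw [← Finset.prod_filter, hf, Finset.prod_pair h0, div_mul_div_comm,
      Real.mul_self_sqrt (by norm_num), one_mul]
  rw [chainScore, chainI_eq hn, chainI_eq hn, h, h, expect_tensorPow_pauli _ hs,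
    expect_tensorPow_pauli _ hs, hp, abs_of_nonneg (by positivity), Real.sqrt_mul hg,
    ← mul_add, mul_comm, Real.sqrt_div (by norm_num), Real.sqrt_one, ← add_div,
    one_add_one_eq_two, Real.div_sqrt]

end NLocal

theorem proposition3 (n : ℕ) (hn : 1 ≤ n) (γ : Fin (n + 1) → ℝ)
    (hγ : ∀ j, γ j ∈ Set.Icc (0 : ℝ) 1) :
    IsGreatest (NLocal.starScore '' NLocal.noisyQuantumSet (NLocal.star n) γ)
      (√2 * (∏ j, (1 - γ j)) ^ (1 / (n : ℝ))) ∧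
    IsGreatest (NLocal.chainScore '' NLocal.noisyQuantumSet (NLocal.chain n) γ)
      (√2 * √(∏ j, (1 - γ j))) := by
  refine ⟨⟨NLocal.exists_starScore_eq hn γ hγ, ?_⟩, ⟨NLocal.exists_chainScore_eq hn γ hγ, ?_⟩⟩
  · rintro _ ⟨P, hP, rfl⟩
    exact NLocal.starScore_le hn γ hγ hP
  · rintro _ ⟨P, hP, rfl⟩
    exact NLocal.chainScore_le hn γ hγ hP
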